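/- **Theorem (correctness of the OMF algorithm).** Let $\mathbb K$ be a field, $n>1$, and let $\mathbf a\in\mathbb K[s]^n$ be a row vector with $\gcd(\mathbf a)=1$. Then the output $P$ of the OMF algorithm on input $\mathbf a$ is a degree-optimal moving frame at $\mathbf a$. *Definitions.* The degree of a polynomial vector is the maximum of the degrees of its components; $P_{*i}$ is the $i$-th column of $P$. A *moving frame* at $\mathbf a\neq 0$ is a matrix $P\in GL_n(\mathbb K[s])$ with $\mathbf a P=[\gcd(\mathbf a),0,\dots,0]$, where $\gcd(\mathbf a)$ is the greatest monic common divisor. It is *degree-optimal* if $\deg P_{*2}\le\dots\le\deg P_{*n}$ and, for every moving frame $P'$ at $\mathbf a$ with $\deg P'_{*2}\le\dots\le\deg P'_{*n}$, one has $\deg P_{*i}\le\deg P'_{*i}$ for all $i=1,\dots,n$. *The OMF algorithm.* 1. Let $d=\deg\mathbf a$ and write $\mathbf a=c_0+c_1s+\dots+c_ds^d$ with $c_i\in\mathbb K^n$. Let $A\in\mathbb K^{(2d+1)\times n(d+1)}$ consist of $d+1$ blocks of $n$ columns, the $k$-th block ($k=0,\dots,d$) having row $c_i$ in row $k+i+1$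 for $0\le i\le d$ and zeros elsewhere. Let $W=[A\mid e_1]$ with $e_1=[1,0,\dots,0]^T\in\mathbb K^{2d+1}$. 2. Construct the partial reduced row-echelon form $E$ of $W$ by Gauss–Jordan elimination, treating the columns of $A$ from left to right. A column whose index is congruent modulo $n$ to the index of a non-pivotal column found before (a periodic non-pivotal column) is skipped. To any other column, apply the row operations performed so far; if, with $r$ pivots found so far, its entries in rows $r+1,\dots,2d+1$ all vanish, its index is recorded as a basic non-pivotal index; otherwise its index is recorded as pivotal, a nonzero entry in one of these rows is chosen (by any rule), and row operations are used to move it to row $r+1$, to normalize it to $1$, and to clear all other entries of the column. The row operations are carried out only on the pivotal columns, the basic non-pivotal columns and the last column of $W$. Let $p_1<p_2<\cdots$ be the pivotal and $\tilde q_1<\tilde q_2<\cdots$ the basic non-pivotal indices found. 3. Start with the $n\times n$ zero matrix $P$. For $j=2,\dots,n$, add $s^{k}$ to $P_{r,j}$, where $\tilde q_{j-1}-1=kn+(r-1)$ with $1\le r\le n$. Then for $i=1,\dots,2d+1$, with $p_i-1=kn+(r-1)$ and $1\le r\le n$, add $E_{i,nd+n+1}\,s^k$ to $P_{r,1}$ and,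 for $j=2,\dots,n$, subtract $E_{i,\tilde q_{j-1}}\,s^k$ from $P_{r,j}$. Output $P$. -/

import Mathlib

open Polynomial

namespace OMF

/-! ## Polynomial vectors, moving frames, degree-optimality -/

section Frames

variable {K : Type*} [Field K] {n : ℕ}

/-- The degree of a polynomial vector: the maximum of the degrees of its components
(`⊥` for the zero vector). -/
noncomputable def vecDegree (h : Fin n → K[X]) : WithBot ℕ :=
  Finset.univ.sup fun i => (h i).degree

/-- The degree of a polynomial vector as a natural number (`0` for the zero vector). -/
noncomputable def vecNatDegree (h : Fin n → K[X]) : ℕ :=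
  (vecDegree h).unbotD 0

/-- `g` is the greatest monic common divisor of the components of `a`. -/
def IsMonicGcd (a : Fin n → K[X]) (g : K[X]) : Prop :=
  g.Monic ∧ (∀ i, g ∣ a i) ∧ ∀ f : K[X], (∀ i, f ∣ a i) → f ∣ g

/-- `P` is an (algebraic) moving frame at the row vector `a`: `P` is invertible over `K[s]` and
`a P = [gcd(a), 0, …, 0]`. -/
def IsMovingFrame [NeZero n] (a : Fin n → K[X]) (P : Matrix (Fin n) (Fin n) K[X]) : Prop :=
  IsUnit P ∧ ∃ g : K[X], IsMonicGcd a g ∧ Matrix.vecMul a P = Pi.single 0 g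

/-- The columns of `P` other than the first one are ordered by degree. -/
def DegreeOrdered [NeZero n] (P : Matrix (Fin n) (Fin n) K[X]) : Prop :=
  ∀ i j : Fin n, i ≠ 0 → i ≤ j → vecDegree (P.col i) ≤ vecDegree (P.col j)

/-- Degree-optimal moving frames. -/
structure IsDegreeOptimalFrame [NeZero n] (a : Fin n → K[X])
    (P : Matrix (Fin n) (Fin n) K[X]) : Prop where
  isMovingFrame : IsMovingFrame a P
  degreeOrdered : DegreeOrdered P
  optimal : ∀ P' : Matrix (Fin n) (Fin n) K[X], IsMovingFrame a P' → DegreeOrdered P' →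
    ∀ i, vecDegree (P.col i) ≤ vecDegree (P'.col i)

end Frames

/-! ## Step 1: the matrix `W = [A | e₁]`

Columns of `A` are numbered from `0`; column `c` lies in block `c.divNat` (the quotient of `c`
by `n`) and has position `c.modNat` (the remainder) inside its block. -/

section StepOne

variable {K : Type*} [Field K] {n : ℕ}

/-- The Sylvester-type matrix of `a`, with `d = deg a`: `d + 1` copies of the block of
coefficients of `a`, the `k`-th copy being shifted down by `k`. -/
noncomputable def sylvesterMatrix (a : Fin n → K[X]) :
    Matrix (Fin (2 * vecNatDegree a + 1)) (Fin ((vecNatDegree a + 1) * n)) K :=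
  Matrix.of fun i c =>
    if (c.divNat : ℕ) ≤ i then (a c.modNat).coeff (i - c.divNat) else 0

/-- The augmented matrix `W = [A | e₁]`. -/
noncomputable def augmentedMatrix (a : Fin n → K[X]) :
    Matrix (Fin (2 * vecNatDegree a + 1)) (Fin ((vecNatDegree a + 1) * n) ⊕ Unit) K :=
  Matrix.fromCols (sylvesterMatrix a) (Matrix.replicateCol Unit (Pi.single 0 1))

end StepOne

/-! ## Step 2: partial Gauss-Jordan elimination -/

section StepTwo

variable {K : Type*} [Field K] [DecidableEq K] {m b n : ℕ}

/-- Elementary row operations on matrices with `m` rows. -/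
inductive RowOp (K : Type*) (m : ℕ) where
  /-- Exchange rows `i` and `j`. -/
  | swap (i j : Fin m)
  /-- Multiply row `i` by `c`. -/
  | scale (i : Fin m) (c : K)
  /-- Add `c` times row `j` to row `i`. -/
  | addMul (i j : Fin m) (c : K)

/-- The effect of a row operation on a single column. -/
def RowOp.apply : RowOp K m → (Fin m → K) → Fin m → K
  | .swap i j, v => v ∘ Equiv.swap i j
  | .scale i c, v => Function.update v i (c * v i)
  | .addMul i j c, v => Function.update v i (v i + c * v j)

/-- Carry out a list of row operations, first one first, on a single column. -/
def applyOps (ops : List (RowOp K m)) (v : Fin m → K) : Fin m → K :=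
  ops.foldl (fun w op => op.apply w) v

/-- A rule for choosing pivots: if the column `v` has a nonzero entry in a row of index `≥ r`,
the rule picks such a row. -/
structure PivotRule (K : Type*) [Field K] (m : ℕ) where
  pick : (v : Fin m → K) → (r : ℕ) → Option {i : Fin m // r ≤ (i : ℕ) ∧ v i ≠ 0}
  eq_zero_of_pick_eq_none : ∀ v r, pick v r = none → ∀ i : Fin m, r ≤ (i : ℕ) → v i = 0

/-- The rule that picks the first possible row. -/
instance : Inhabited (PivotRule K m) where
  default :=
    { pick := fun v r =>
        ((List.finRange m).filterMap fun i : Fin m =>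
          if h : r ≤ (i : ℕ) ∧ v i ≠ 0 then some ⟨i, h⟩ else none).head?
      eq_zero_of_pick_eq_none := by
        intro v r h i hi
        by_contra hv
        rw [List.head?_eq_none_iff, List.filterMap_eq_nil_iff] at h
        have h2 := h i (List.mem_finRange i)
        rw [dif_pos ⟨hi, hv⟩] at h2
        exact Option.some_ne_none _ h2 }

/-- The row operations performed for the pivot in row `i` of the current column `v`: bring it to
row `r`, normalize it, and clear the entries of the column below and above it. -/
def pivotOps (v : Fin m → K) (r i : Fin m) : List (RowOp K m) :=
  let w := v ∘ Equiv.swap r i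
  .swap r i :: .scale r (w r)⁻¹ ::
    ((List.finRange m).filter (· ≠ r)).map fun k => .addMul k r (-(w k))

/-- State of the elimination: the row operations performed so far (in order), the pivotal
indices and the basic non-pivotal indices found so far (in increasing order). -/
structure GJState (K : Type*) (m N : ℕ) where
  ops : List (RowOp K m)
  pivots : List (Fin N)
  basic : List (Fin N)

/-- Treatment of column `c` of `A`, all preceding columns having been treated. The column is
skipped if it is periodic, that is, congruent modulo `n` to a non-pivotal index found before.
Otherwise the row operations performed so far are carried out on it; if it has no nonzero entry
outside the pivot rows, it is non-pivotal, else it is pivotal and is reduced. -/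
def gjStep (rule : PivotRule K m) (A : Matrix (Fin m) (Fin (b * n)) K)
    (st : GJState K m (b * n)) (c : Fin (b * n)) : GJState K m (b * n) :=
  if ∃ q ∈ st.basic, q.modNat = c.modNat then st
  else
    let v := applyOps st.ops (A.col c)
    match rule.pick v st.pivots.length with
    | none => { st with basic := st.basic ++ [c] }
    | some i =>
      { ops := st.ops ++
          pivotOps v ⟨st.pivots.length, lt_of_le_of_lt i.2.1 i.1.isLt⟩ i.1
        pivots := st.pivots ++ [c]
        basic := st.basic }

/-- Treatment of all columns of `A`, from left to right. -/
def gaussJordan (rule : PivotRule K m) (A : Matrix (Fin m) (Fin (b * n)) K) :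
    GJState K m (b * n) :=
  (List.finRange (b * n)).foldl (gjStep rule A) ⟨[], [], []⟩

/-- The partial reduced row-echelon form of `W`: the row operations are carried out only on the
pivotal columns, the basic non-pivotal columns and the last column. -/
def partialRref (st : GJState K m (b * n)) (W : Matrix (Fin m) (Fin (b * n) ⊕ Unit) K) :
    Matrix (Fin m) (Fin (b * n) ⊕ Unit) K :=
  Matrix.of fun i c =>
    match c with
    | .inl c =>
      if c ∈ st.pivots ∨ c ∈ st.basic then applyOps st.ops (W.col (.inl c)) i else W i (.inl c)
    | .inr u => applyOps st.ops (W.col (.inr u)) i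

end StepTwo

/-! ## Step 3: reading off the frame, and the whole algorithm -/

section StepThree

variable {K : Type*} [Field K]

/-- Construction of `P` from the partial reduced row-echelon form `E`, the list `p` of pivotal
indices and the list `q` of basic non-pivotal indices. The pairs in `js` are the column numbers
`j` of `P` other than the first one with the corresponding element of `q`; the pairs in `is` are
the row numbers `i` of `E` with the `i`-th element of `p`. -/
noncomputable def readOff {m b n : ℕ} [NeZero n] (E : Matrix (Fin m) (Fin (b * n) ⊕ Unit) K)
    (p q : List (Fin (b * n))) : Matrix (Fin n) (Fin n) K[X] :=
  let js : List (Fin n × Fin (b * n)) := (List.finRange n).tail.zip q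
  let is : List (Fin m × Fin (b * n)) := (List.finRange m).zip p
  (js.map fun t => Matrix.single t.2.modNat t.1 (X ^ (t.2.divNat : ℕ))).sum +
  (is.map fun u =>
    Matrix.single u.2.modNat 0 (C (E u.1 (.inr ())) * X ^ (u.2.divNat : ℕ)) -
    (js.map fun t =>
      Matrix.single u.2.modNat t.1 (C (E u.1 (.inl t.2)) * X ^ (u.2.divNat : ℕ))).sum).sum

/-- The output of the OMF algorithm on the input `a`. -/
noncomputable def omf [DecidableEq K] {n : ℕ} [NeZero n] (a : Fin n → K[X])
    (rule : PivotRule K (2 * vecNatDegree a + 1)) : Matrix (Fin n) (Fin n) K[X] :=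
  let W := augmentedMatrix a
  let st := gaussJordan rule W.toCols₁
  let E := partialRref st W
  readOff E st.pivots st.basic

end StepThree

end OMF

/-! Order the monomial vectors `s^k e_r` by degree, then by position, that is, by the flat index `c
= n k + r`. The columns of the matrix `A` are the coefficient vectors of the products of `a` with
the monomial vectors of degree at most `d`. Linear relations among them are thus syzygies of `a`,
and multiplication by `s` shifts indices by `n`. A basic non-pivotal column is a combination of
earlier pivotal ones; this relation is a syzygy whose lead is that index, and its shifts account for
the periodic columns, so these may be skipped. A pivotal index is never the lead of a syzygy
(`lead_notMem_pivotSet`).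

Bézout's identity with degree bounds (`IsMonicGcd.exists_dotProduct_eq`) shows that `A` has rank `2d
+ 1` and its first `d` blocks rank at least `2d`. Hence at most one pivot lies in the last block,
and at least `n - 1` residue classes modulo `n` contain a basic index; a determinant excludes `n` of
them (`not_isLead_of_syzygies`). So the output has `n - 1` syzygy columns with leads minimal in
distinct classes, and a first column supported on pivotal indices (`isReducedFrame_omf`).

Such a matrix is degree-optimal by division with remainder: every syzygy reduces to zero modulo
those syzygy columns whose leads do not exceed its own (`mem_span`). This yields invertibility and,
by counting independent vectors, minimality of the syzygy columns. No syzygy can cancel the lead of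
the first column, so its degree is least as well. -/

namespace OMF

/-! ### Leading monomials of polynomial vectors -/

section Leads

variable {K : Type*} [Field K] {n : ℕ} [NeZero n]

/-- The position of the flat index `c` inside its block of length `n`. -/
def position (n : ℕ) [NeZero n] (c : ℕ) : Fin n := ⟨c % n, Nat.mod_lt _ (NeZero.pos n)⟩

/-- The coefficient of a polynomial vector at the flat index `c`, which stands for the monomial
`s ^ (c / n)` at position `c % n`. -/
def coef (h : Fin n → K[X]) (c : ℕ) : K := (h (position n c)).coeff (c / n)

/-- The monomial vector with flat index `c`. -/
noncomputable def monoVec (K : Type*) [Field K] (n : ℕ) [NeZero n] (c : ℕ) : Fin n → K[X] :=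
  Pi.single (position n c) (X ^ (c / n))

/-- `c` is the largest flat index at which `h` has a nonzero coefficient. -/
def IsLead (h : Fin n → K[X]) (c : ℕ) : Prop := coef h c ≠ 0 ∧ ∀ c', c < c' → coef h c' = 0

theorem position_add_mul (r : Fin n) (k : ℕ) : position n (r + n * k) = r := by
  apply Fin.ext
  simp [position, Nat.mod_eq_of_lt r.isLt]

theorem add_mul_div (r : Fin n) (k : ℕ) : ((r : ℕ) + n * k) / n = k := by
  rw [Nat.add_mul_div_left _ _ (NeZero.pos n), Nat.div_eq_of_lt r.isLt, zero_add]

theorem coef_add_mul (h : Fin n → K[X]) (r : Fin n) (k : ℕ) :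
    coef h (r + n * k) = (h r).coeff k := by
  rw [coef, position_add_mul, add_mul_div]

theorem coef_ext {h h' : Fin n → K[X]} (H : ∀ c, coef h c = coef h' c) : h = h' := by
  funext r
  ext k
  rw [← coef_add_mul, ← coef_add_mul, H]

@[simp] theorem coef_zero (c : ℕ) : coef (0 : Fin n → K[X]) c = 0 := by simp [coef]

theorem coef_sub (h h' : Fin n → K[X]) (c : ℕ) : coef (h - h') c = coef h c - coef h' c := by
  simp [coef]

theorem coef_C_smul (x : K) (h : Fin n → K[X]) (c : ℕ) : coef (C x • h) c = x * coef h c := by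
  simp [coef]

theorem coef_sum {ι : Type*} (s : Finset ι) (h : ι → Fin n → K[X]) (c : ℕ) :
    coef (∑ i ∈ s, h i) c = ∑ i ∈ s, coef (h i) c := by
  simp [coef, Finset.sum_apply]

theorem coef_monoVec (c c' : ℕ) : coef (monoVec K n c) c' = if c' = c then 1 else 0 := by
  unfold coef monoVec
  by_cases h : position n c' = position n c
  · rw [h, Pi.single_eq_same, coeff_X_pow]
    have h' : c' % n = c % n := congrArg Fin.val h
    congr 1
    refine propext ⟨fun H => ?_, fun H => by rw [H]⟩
    rw [← Nat.div_add_mod c' n, ← Nat.div_add_mod c n, H, h']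
  · rw [Pi.single_eq_of_ne h, if_neg, coeff_zero]
    rintro rfl
    exact h rfl

theorem IsLead.coeff_eq_zero {h : Fin n → K[X]} {c : ℕ} (H : IsLead h c) (r : Fin n) {k : ℕ}
    (hk : c < r + n * k) : (h r).coeff k = 0 := by
  rw [← coef_add_mul]
  exact H.2 _ hk

theorem IsLead.ne_zero {h : Fin n → K[X]} {c : ℕ} (H : IsLead h c) : h ≠ 0 := by
  rintro rfl
  exact H.1 (coef_zero c)

theorem exists_coef_eq_zero (h : Fin n → K[X]) : ∃ B, ∀ c, B ≤ c → coef h c = 0 := by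
  refine ⟨n * (Finset.univ.sup (fun r => (h r).natDegree) + 1), fun c hc => ?_⟩
  apply coeff_eq_zero_of_natDegree_lt
  calc (h (position n c)).natDegree ≤ Finset.univ.sup (fun r => (h r).natDegree) :=
        Finset.le_sup (f := fun r => (h r).natDegree) (Finset.mem_univ _)
    _ < _ := Nat.lt_succ_self _
    _ ≤ c / n := (Nat.le_div_iff_mul_le (NeZero.pos n)).2 (by rwa [mul_comm])

theorem exists_isLead_of_coef_eq_zero {h : Fin n → K[X]} (hh : h ≠ 0) {B : ℕ}
    (hB : ∀ c, B ≤ c → coef h c = 0) : ∃ c < B, IsLead h c := by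
  induction B with
  | zero => exact absurd (coef_ext fun c => by rw [hB c (Nat.zero_le c), coef_zero]) hh
  | succ B ih =>
    by_cases h0 : coef h B = 0
    · obtain ⟨c, hc, H⟩ := ih fun c hc => by
        rcases hc.eq_or_lt with rfl | hc
        · exact h0
        · exact hB c hc
      exact ⟨c, hc.trans (Nat.lt_succ_self B), H⟩
    · exact ⟨B, Nat.lt_succ_self B, h0, fun c hc => hB c hc⟩

theorem exists_isLead {h : Fin n → K[X]} (hh : h ≠ 0) : ∃ c, IsLead h c := by
  obtain ⟨B, hB⟩ := exists_coef_eq_zero h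
  obtain ⟨c, -, hc⟩ := exists_isLead_of_coef_eq_zero hh hB
  exact ⟨c, hc⟩

theorem IsLead.vecDegree_eq {h : Fin n → K[X]} {c : ℕ} (H : IsLead h c) :
    vecDegree h = ((c / n : ℕ) : WithBot ℕ) := by
  apply le_antisymm
  · refine Finset.sup_le fun r _ => (degree_le_iff_coeff_zero _ _).2 fun k hk => ?_
    apply H.coeff_eq_zero
    have hk : c / n < k := by exact_mod_cast hk
    have := Nat.lt_mul_of_div_lt hk (NeZero.pos n)
    rw [mul_comm] at this
    omega
  · exact (le_degree_of_ne_zero H.1).trans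
      (Finset.le_sup (f := fun i => (h i).degree) (Finset.mem_univ (position n c)))

/-- The order on flat indices is compatible with multiplication by `X`, so leading terms multiply.
In particular the residue of the lead modulo `n` does not change. -/
theorem IsLead.smul {h : Fin n → K[X]} {c : ℕ} (H : IsLead h c) {g : K[X]} (hg : g ≠ 0) :
    IsLead (g • h) (c + n * g.natDegree) := by
  have hn := NeZero.pos n
  constructor
  · have h1 : position n (c + n * g.natDegree) = position n c := Fin.ext (by simp [position])
    have h2 : (h (position n c)).natDegree ≤ c / n := by
      refine natDegree_le_iff_coeff_eq_zero.2 fun k hk => H.coeff_eq_zero _ ?_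
      have := Nat.lt_mul_of_div_lt hk hn
      rw [mul_comm] at this
      omega
    rw [coef, h1, Nat.add_mul_div_left _ _ hn, Pi.smul_apply, smul_eq_mul, add_comm,
      coeff_mul_add_eq_of_natDegree_le le_rfl h2]
    exact mul_ne_zero (leadingCoeff_ne_zero.2 hg) H.1
  · intro c' hc'
    rw [coef, Pi.smul_apply, smul_eq_mul, coeff_mul]
    refine Finset.sum_eq_zero fun x hx => ?_
    rw [Finset.HasAntidiagonal.mem_antidiagonal] at hx
    by_cases hx1 : g.natDegree < x.1
    · rw [coeff_eq_zero_of_natDegree_lt hx1, zero_mul]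
    · rw [H.coeff_eq_zero, mul_zero]
      have h3 : n * (c' / n) + c' % n = c' := Nat.div_add_mod c' n
      have h4 : n * x.1 ≤ n * g.natDegree := Nat.mul_le_mul_left n (by omega)
      rw [← hx, mul_add] at h3
      simp only [position]
      omega

/-- The nonzero terms `g i • u i` have leads in distinct residue classes, so the largest of these
leads cannot cancel. -/
theorem eq_zero_of_sum_smul_eq_zero {ι : Type*} [Fintype ι] {u : ι → Fin n → K[X]} {q : ι → ℕ}
    (hu : ∀ i, IsLead (u i) (q i)) (hq : ∀ i j, q i % n = q j % n → i = j) {g : ι → K[X]}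
    (hg : ∑ i, g i • u i = 0) (i : ι) : g i = 0 := by
  classical
  by_contra hi
  obtain ⟨j, hj, hmax⟩ := Finset.exists_max_image (Finset.univ.filter fun i => g i ≠ 0)
    (fun i => q i + n * (g i).natDegree) ⟨i, by simpa using hi⟩
  have hj0 : g j ≠ 0 := (Finset.mem_filter.1 hj).2
  have h1 := congrArg (fun h => coef h (q j + n * (g j).natDegree)) hg
  simp only [coef_sum, coef_zero] at h1
  rw [Finset.sum_eq_single j] at h1
  · exact ((hu j).smul hj0).1 h1
  · intro k _ hk
    by_cases hk0 : g k = 0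
    · simp [hk0]
    apply ((hu k).smul hk0).2
    refine lt_of_le_of_ne (hmax k (by simpa using hk0)) fun h => hk (hq _ _ ?_)
    simpa using congrArg (· % n) h
  · simp

/-- There are at most `n - 1` syzygies with leads in different positions. -/
theorem not_isLead_of_syzygies {a : Fin n → K[X]} (ha : a ≠ 0) {u : Fin n → Fin n → K[X]}
    {q : Fin n → ℕ} (hu : ∀ i, IsLead (u i) (q i)) (hq : ∀ i j, q i % n = q j % n → i = j)
    (h0 : ∀ i, a ⬝ᵥ u i = 0) : False := by
  -- Since `a ≠ 0` annihilates this matrix from the left, it is singular; a kernel vector on the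
  -- right is then a nontrivial relation among the `u i`.
  have h1 : (Matrix.of fun r i => u i r).det = 0 := by
    rw [← Matrix.exists_vecMul_eq_zero_iff]
    exact ⟨a, ha, funext fun i => h0 i⟩
  rw [← Matrix.exists_mulVec_eq_zero_iff] at h1
  obtain ⟨g, hg, h2⟩ := h1
  refine hg (funext (eq_zero_of_sum_smul_eq_zero hu hq ?_))
  funext r
  rw [← h2]
  simp [Matrix.mulVec, dotProduct, mul_comm]

/-- The columns of `P` are a vector `v` with `a v = 1` and syzygies of `a` whose leads are
minimal in their positions. -/
structure IsReducedFrame (a : Fin n → K[X]) (P : Matrix (Fin n) (Fin n) K[X]) (q : Fin n → ℕ) :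
    Prop where
  dot_zero : a ⬝ᵥ P.col 0 = 1
  dot : ∀ j, j ≠ 0 → a ⬝ᵥ P.col j = 0
  lead : ∀ j, j ≠ 0 → IsLead (P.col j) (q j)
  lt : ∀ i j, i ≠ 0 → i < j → q i < q j
  mod : ∀ i j, i ≠ 0 → j ≠ 0 → q i % n = q j % n → i = j
  min : ∀ h c, a ⬝ᵥ h = 0 → IsLead h c → ∀ j, j ≠ 0 → c % n = q j % n → q j ≤ c
  lead_zero : ∀ h c, a ⬝ᵥ h = 0 → IsLead h c → ¬ IsLead (P.col 0) c

/-! ### Reduced frames are degree-optimal -/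

namespace IsReducedFrame

variable {a : Fin n → K[X]} {P : Matrix (Fin n) (Fin n) K[X]} {q : Fin n → ℕ}

theorem ne_zero (H : IsReducedFrame a P q) : a ≠ 0 := by
  rintro rfl
  simpa using H.dot_zero

/-- The syzygy columns already occupy `n - 1` residue classes. A syzygy with lead in the remaining
class, placed in slot `0`, would give `n` of them. -/
theorem exists_mod_eq (H : IsReducedFrame a P q) {h : Fin n → K[X]} {c : ℕ} (h0 : a ⬝ᵥ h = 0)
    (hc : IsLead h c) : ∃ j, j ≠ 0 ∧ c % n = q j % n := by
  by_contra! hne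
  refine not_isLead_of_syzygies H.ne_zero (u := fun j => if j = 0 then h else P.col j)
    (q := fun j => if j = 0 then c else q j) (fun i => ?_) (fun i j => ?_) (fun i => ?_)
  · by_cases hi : i = 0
    · simpa [hi] using hc
    · simpa [hi] using H.lead i hi
  · by_cases hi : i = 0 <;> by_cases hj : j = 0
    · simp [hi, hj]
    · simp only [hi, hj, if_true, if_false]
      exact fun h => absurd h (hne j hj)
    · simp only [hi, hj, if_true, if_false]
      exact fun h => absurd h.symm (hne i hi)
    · simp only [hi, hj, if_false]
      exact H.mod i j hi hj
  · by_cases hi : i = 0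
    · simpa [hi] using h0
    · simpa [hi] using H.dot i hi

/-- Division algorithm: the lead of `h` is a shift of some `q j`, by minimality of `q j` in its
class. Subtracting a monomial multiple of that column lowers the lead. -/
theorem mem_span (H : IsReducedFrame a P q) {h : Fin n → K[X]} {c : ℕ} (h0 : a ⬝ᵥ h = 0)
    (hc : IsLead h c) : h ∈ Submodule.span K[X] (P.col '' {j | j ≠ 0 ∧ q j ≤ c}) := by
  induction c using Nat.strong_induction_on generalizing h with
  | _ c ih =>
    obtain ⟨j, hj, hmod⟩ := H.exists_mod_eq h0 hc
    have hle := H.min h c h0 hc j hj hmod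
    -- The factor `g = x X ^ (c / n - q j / n)` makes the leading terms of `g • P.col j` and `h`
    -- agree.
    set x : K := coef h c / coef (P.col j) (q j) with hx
    set g : K[X] := C x * X ^ (c / n - q j / n) with hg
    have hx0 : x ≠ 0 := div_ne_zero hc.1 (H.lead j hj).1
    have hg0 : g ≠ 0 := mul_ne_zero (C_ne_zero.2 hx0) (pow_ne_zero _ X_ne_zero)
    have hgd : g.natDegree = c / n - q j / n := by
      rw [hg, natDegree_C_mul hx0, natDegree_X_pow]
    have hdiv : q j / n ≤ c / n := Nat.div_le_div_right hle
    have hcq : q j + n * g.natDegree = c := by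
      rw [hgd, Nat.mul_sub, ← Nat.div_add_mod c n]
      have h1 := Nat.div_add_mod (q j) n
      have h2 := Nat.mul_le_mul_left n hdiv
      rw [Nat.div_add_mod c n]
      have h3 := Nat.div_add_mod c n
      omega
    have hlead := (H.lead j hj).smul hg0
    rw [hcq] at hlead
    have hmem : g • P.col j ∈ Submodule.span K[X] (P.col '' {j | j ≠ 0 ∧ q j ≤ c}) :=
      Submodule.smul_mem _ _ (Submodule.subset_span ⟨j, ⟨hj, hle⟩, rfl⟩)
    have hcoef : coef (g • P.col j) c = coef h c := by
      have h1 : position n c = position n (q j) := Fin.ext hmod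
      have h2 : c / n = q j / n + (c / n - q j / n) := by omega
      rw [coef, h1, Pi.smul_apply, smul_eq_mul, hg, mul_assoc, coeff_C_mul, h2,
        Nat.add_sub_cancel_left, mul_comm (X ^ _), coeff_mul_X_pow]
      exact div_mul_cancel₀ _ (H.lead j hj).1
    by_cases hz : h - g • P.col j = 0
    · rwa [sub_eq_zero.1 hz]
    · obtain ⟨c', hc', hl⟩ := exists_isLead_of_coef_eq_zero hz (B := c) fun c' hc' => by
        rw [coef_sub]
        rcases hc'.eq_or_lt with rfl | hc'
        · rw [hcoef, sub_self]
        · rw [hc.2 c' hc', hlead.2 c' hc', sub_self]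
      have h1 := ih c' hc' (h := h - g • P.col j)
        (by rw [dotProduct_sub, dotProduct_smul, h0, H.dot j hj, smul_zero, sub_zero]) hl
      rw [← sub_add_cancel h (g • P.col j)]
      refine Submodule.add_mem _ (Submodule.span_mono (Set.image_mono ?_) h1) hmem
      exact fun i hi => ⟨hi.1, hi.2.trans hc'.le⟩

/-- Any `h` is `(a ⬝ᵥ h) • P.col 0` plus a syzygy, so the columns span and `P` is surjective. -/
theorem isUnit (H : IsReducedFrame a P q) : IsUnit P := by
  rw [← Matrix.mulVec_surjective_iff_isUnit]
  have key : ∀ h, h ∈ Submodule.span K[X] (Set.range P.col) := fun h => by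
    have h1 : h - (a ⬝ᵥ h) • P.col 0 ∈ Submodule.span K[X] (Set.range P.col) := by
      by_cases hz : h - (a ⬝ᵥ h) • P.col 0 = 0
      · rw [hz]
        exact Submodule.zero_mem _
      · obtain ⟨c, hc⟩ := exists_isLead hz
        refine Submodule.span_mono (Set.image_subset_range _ _) (H.mem_span ?_ hc)
        rw [dotProduct_sub, dotProduct_smul, H.dot_zero, smul_eq_mul, mul_one, sub_self]
    rw [← sub_add_cancel h ((a ⬝ᵥ h) • P.col 0)]
    exact Submodule.add_mem _ h1 (Submodule.smul_mem _ _ (Submodule.subset_span ⟨0, rfl⟩))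
  intro h
  have := key h
  rw [← Matrix.range_mulVecLin] at this
  exact this

theorem degreeOrdered (H : IsReducedFrame a P q) : DegreeOrdered P := by
  intro i j hi hij
  rcases hij.eq_or_lt with rfl | hij
  · exact le_rfl
  have hj : j ≠ 0 := fun hj => by
    rw [hj] at hij
    exact Fin.not_lt_zero _ hij
  rw [(H.lead i hi).vecDegree_eq, (H.lead j hj).vecDegree_eq]
  exact_mod_cast Nat.div_le_div_right (H.lt i j hi hij).le

theorem dot_eq_one_of_isMovingFrame (ha : IsMonicGcd a 1) {P' : Matrix (Fin n) (Fin n) K[X]}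
    (hP' : IsMovingFrame a P') : a ⬝ᵥ P'.col 0 = 1 ∧ ∀ j, j ≠ 0 → a ⬝ᵥ P'.col j = 0 := by
  obtain ⟨-, g, hg, h⟩ := hP'
  have hg1 : g = 1 := hg.1.eq_one_of_isUnit (isUnit_of_dvd_one (ha.2.2 g hg.2.1))
  have h1 : ∀ j, a ⬝ᵥ P'.col j = (Pi.single 0 g : Fin n → K[X]) j := fun j => congrFun h j
  refine ⟨by rw [h1, Pi.single_eq_same, hg1], fun j hj => by rw [h1, Pi.single_eq_of_ne hj]⟩

/-- If `v` had smaller degree, the syzygy `P.col 0 - v` would have the same lead as `P.col 0`. -/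
theorem optimal_zero (H : IsReducedFrame a P q) {v : Fin n → K[X]} (hv : a ⬝ᵥ v = 1) :
    vecDegree (P.col 0) ≤ vecDegree v := by
  by_contra! hlt
  have hP0 : P.col 0 ≠ 0 := fun h => by simpa [h] using H.dot_zero
  obtain ⟨c, hc⟩ := exists_isLead hP0
  have hv0 : v ≠ 0 := fun h => by simp [h] at hv
  obtain ⟨c', hc'⟩ := exists_isLead hv0
  rw [hc.vecDegree_eq, hc'.vecDegree_eq] at hlt
  have hlt : c' / n < c / n := by exact_mod_cast hlt
  have hcc : c' < c := by
    by_contra! h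
    exact absurd (Nat.div_le_div_right (c := n) h) (by omega)
  refine H.lead_zero (P.col 0 - v) c (by rw [dotProduct_sub, H.dot_zero, hv, sub_self]) ⟨?_, ?_⟩ hc
  · rw [coef_sub, hc'.2 c hcc, sub_zero]
    exact hc.1
  · intro x hx
    rw [coef_sub, hc.2 x hx, hc'.2 x (hcc.trans hx), sub_zero]

/-- Otherwise all syzygy columns of `P'` up to the `j`-th have leads below `q j` and lie in the span
of the syzygy columns of `P` before the `j`-th: too many independent vectors. -/
theorem optimal (H : IsReducedFrame a P q) {P' : Matrix (Fin n) (Fin n) K[X]} (hu : IsUnit P')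
    (h0 : ∀ j, j ≠ 0 → a ⬝ᵥ P'.col j = 0) (hord : DegreeOrdered P') {j : Fin n} (hj : j ≠ 0) :
    vecDegree (P.col j) ≤ vecDegree (P'.col j) := by
  classical
  by_contra! hlt
  have hli : LinearIndependent K[X] P'.col := Matrix.linearIndependent_cols_of_isUnit hu
  set s : Finset (Fin n) := Finset.univ.filter fun l => l ≠ 0 ∧ l < j with hs
  set t : Finset (Fin n) := Finset.univ.filter fun l => l ≠ 0 ∧ l ≤ j with ht
  have hli' := hli.comp (Subtype.val : t → Fin n) Subtype.val_injective
  have hsub : Set.range (P'.col ∘ (Subtype.val : t → Fin n)) ⊆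
      Submodule.span K[X] ((s.image P.col : Finset _) : Set (Fin n → K[X])) := by
    rintro _ ⟨⟨i, hi⟩, rfl⟩
    obtain ⟨hi0, hij⟩ := (Finset.mem_filter.1 hi).2
    obtain ⟨c, hc⟩ := exists_isLead (hli.ne_zero i)
    have hd := (hord i j hi0 hij).trans_lt hlt
    rw [hc.vecDegree_eq, (H.lead j hj).vecDegree_eq] at hd
    have hd : c / n < q j / n := by exact_mod_cast hd
    have hcq : c < q j := by
      by_contra! h
      exact absurd (Nat.div_le_div_right (c := n) h) (by omega)
    refine Submodule.span_mono ?_ (H.mem_span (h0 i hi0) hc)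
    rintro _ ⟨l, ⟨hl0, hl⟩, rfl⟩
    rw [Finset.coe_image]
    refine ⟨l, ?_, rfl⟩
    simp only [hs, Finset.coe_filter, Finset.mem_univ, true_and, Set.mem_ofPred_eq]
    refine ⟨hl0, not_le.1 fun hjl => ?_⟩
    rcases hjl.eq_or_lt with rfl | hjl
    · omega
    · have := H.lt j l hj hjl
      omega
  have h1 := linearIndependent_le_span' _ hli' _ hsub
  have h2 : t.card ≤ s.card := by
    refine le_trans ?_ (Finset.card_image_le (s := s) (f := P.col))
    simpa using h1
  have h3 : s ⊂ t := by
    refine (Finset.ssubset_iff_of_subset fun l hl => ?_).2 ⟨j, by simp [ht, hj], by simp [hs]⟩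
    simp only [hs, ht, Finset.mem_filter, Finset.mem_univ, true_and] at hl ⊢
    exact ⟨hl.1, hl.2.le⟩
  exact absurd (Finset.card_lt_card h3) (by omega)

theorem isDegreeOptimalFrame (H : IsReducedFrame a P q) (ha : IsMonicGcd a 1) :
    IsDegreeOptimalFrame a P where
  isMovingFrame := by
    refine ⟨H.isUnit, 1, ha, funext fun j => ?_⟩
    change a ⬝ᵥ P.col j = _
    by_cases hj : j = 0
    · rw [hj, H.dot_zero, Pi.single_eq_same]
    · rw [H.dot j hj, Pi.single_eq_of_ne hj]
  degreeOrdered := H.degreeOrdered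
  optimal P' hP' hord i := by
    obtain ⟨h1, h2⟩ := dot_eq_one_of_isMovingFrame ha hP'
    by_cases hi : i = 0
    · rw [hi]
      exact H.optimal_zero h1
    · exact H.optimal hP'.1 h2 hord hi

end IsReducedFrame

end Leads

/-! ### Gauss–Jordan elimination and its invariant -/

section Elimination

variable {K : Type*} [Field K] {m b n : ℕ}

theorem isLinearMap_apply (op : RowOp K m) : IsLinearMap K op.apply := by
  constructor
  · intro x y
    funext k
    cases op with
    | swap i j => rfl
    | scale i c =>
      by_cases h : k = i
      · subst h
        simp [RowOp.apply, mul_add]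
      · simp [RowOp.apply, h]
    | addMul i j c =>
      by_cases h : k = i
      · subst h
        simp only [RowOp.apply, Function.update_self, Pi.add_apply]
        ring
      · simp [RowOp.apply, h]
  · intro x y
    funext k
    cases op with
    | swap i j => rfl
    | scale i c =>
      by_cases h : k = i
      · subst h
        simp only [RowOp.apply, Function.update_self, Pi.smul_apply, smul_eq_mul]
        ring
      · simp [RowOp.apply, h]
    | addMul i j c =>
      by_cases h : k = i
      · subst h
        simp only [RowOp.apply, Function.update_self, Pi.smul_apply, smul_eq_mul]
        ring
      · simp [RowOp.apply, h]

theorem applyOps_append (l l' : List (RowOp K m)) (v : Fin m → K) :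
    applyOps (l ++ l') v = applyOps l' (applyOps l v) :=
  List.foldl_append

theorem isLinearMap_applyOps (ops : List (RowOp K m)) : IsLinearMap K (applyOps ops) := by
  induction ops with
  | nil => exact ⟨fun _ _ => rfl, fun _ _ => rfl⟩
  | cons op ops ih =>
    constructor
    · intro x y
      change applyOps ops (op.apply (x + y)) = _
      rw [(isLinearMap_apply op).map_add, ih.map_add]
      rfl
    · intro c x
      change applyOps ops (op.apply (c • x)) = _
      rw [(isLinearMap_apply op).map_smul, ih.map_smul]
      rfl

theorem applyOps_addMul (r : Fin m) (f : Fin m → K) (l : List (Fin m)) (hl : l.Nodup)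
    (hr : r ∉ l) (x : Fin m → K) (k : Fin m) :
    applyOps (l.map fun k => RowOp.addMul k r (f k)) x k =
      if k ∈ l then x k + f k * x r else x k := by
  induction l generalizing x with
  | nil => simp [applyOps]
  | cons i l ih =>
    rw [List.nodup_cons] at hl
    rw [List.mem_cons, not_or] at hr
    rw [List.map_cons]
    change applyOps (l.map fun k => RowOp.addMul k r (f k))
      (Function.update x i (x i + f i * x r)) k = _
    rw [ih hl.2 hr.2, Function.update_of_ne hr.1]
    by_cases hk : k = i
    · subst hk
      simp [hl.1]
    · simp [hk]

theorem applyOps_pivotOps (v x : Fin m → K) (r i : Fin m) (k : Fin m) :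
    applyOps (pivotOps v r i) x k =
      if k = r then (v i)⁻¹ * x i
      else x (Equiv.swap r i k) - v (Equiv.swap r i k) * ((v i)⁻¹ * x i) := by
  change applyOps (((List.finRange m).filter (· ≠ r)).map
    fun k => RowOp.addMul k r (-((v ∘ Equiv.swap r i) k)))
    (Function.update (x ∘ Equiv.swap r i) r
      (((v ∘ Equiv.swap r i) r)⁻¹ * (x ∘ Equiv.swap r i) r)) k = _
  rw [applyOps_addMul r (fun k => -((v ∘ Equiv.swap r i) k)) _
    ((List.nodup_finRange m).filter _) (by simp)]
  by_cases hk : k = r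
  · subst hk
    simp
  · simp [hk]
    ring

theorem applyOps_pivotOps_self {v : Fin m → K} {i : Fin m} (hv : v i ≠ 0) (r : Fin m) :
    applyOps (pivotOps v r i) v = Pi.single r 1 := by
  funext k
  rw [applyOps_pivotOps, inv_mul_cancel₀ hv]
  by_cases hk : k = r
  · subst hk
    simp
  · simp [hk]

/-- This is why a new pivot leaves the earlier pivotal and basic columns intact: they vanish from
row `r` on. -/
theorem applyOps_pivotOps_of_eq_zero (v : Fin m → K) {x : Fin m → K} {r i : Fin m} (hri : r ≤ i)
    (hx : ∀ k, r ≤ k → x k = 0) : applyOps (pivotOps v r i) x = x := by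
  funext k
  rw [applyOps_pivotOps, hx i hri]
  by_cases hk : k = r
  · subst hk
    simp [hx k le_rfl]
  · by_cases hki : k = i
    · subst hki
      simp [hk, hx k hri, hx r le_rfl]
    · simp [hk, Equiv.swap_apply_of_ne_of_ne hk hki]

theorem applyOps_pivotOps_injective {v : Fin m → K} {i : Fin m} (hv : v i ≠ 0) (r : Fin m) :
    Function.Injective (applyOps (pivotOps v r i)) := by
  intro x y hxy
  have hi : x i = y i := by
    have := congrFun hxy r
    simp only [applyOps_pivotOps, if_true] at this
    exact mul_left_cancel₀ (inv_ne_zero hv) this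
  funext k
  by_cases hk : Equiv.swap r i k = r
  · have : k = i := by
      rw [← Equiv.swap_apply_self r i k, hk, Equiv.swap_apply_left]
    rw [this, hi]
  · have := congrFun hxy (Equiv.swap r i k)
    simp only [applyOps_pivotOps, if_neg hk, Equiv.swap_apply_self, hi] at this
    exact sub_left_injective this

/-- What holds for the state of the elimination after treatment of the first `k` columns. -/
structure GJInvariant (A : Matrix (Fin m) (Fin (b * n)) K) (st : GJState K m (b * n)) (k : ℕ) :
    Prop where
  injective : Function.Injective (applyOps st.ops)
  length_le : st.pivots.length ≤ m
  pivots_lt : ∀ p ∈ st.pivots, (p : ℕ) < k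
  pivots_sorted : st.pivots.Pairwise (· < ·)
  basic_lt : ∀ q ∈ st.basic, (q : ℕ) < k
  basic_sorted : st.basic.Pairwise (· < ·)
  basic_modNat : st.basic.Pairwise fun q q' => q.modNat ≠ q'.modNat
  apply_pivot : ∀ i (hi : i < st.pivots.length) (hm : i < m),
    applyOps st.ops (A.col st.pivots[i]) = Pi.single ⟨i, hm⟩ 1
  apply_basic : ∀ q ∈ st.basic, ∀ r : Fin m, applyOps st.ops (A.col q) r ≠ 0 →
    ∃ h : (r : ℕ) < st.pivots.length, st.pivots[r] < q
  covers : ∀ c : Fin (b * n), (c : ℕ) < k →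
    c ∈ st.pivots ∨ ∃ q ∈ st.basic, q ≤ c ∧ q.modNat = c.modNat

theorem GJInvariant.step [DecidableEq K] {A : Matrix (Fin m) (Fin (b * n)) K}
    {st : GJState K m (b * n)} (c : Fin (b * n)) (H : GJInvariant A st c) (rule : PivotRule K m) :
    GJInvariant A (gjStep rule A st c) (c + 1) := by
  have hcov : ∀ c' : Fin (b * n), (c' : ℕ) < c + 1 → c' ≠ c → (c' : ℕ) < c := fun c' h h' =>
    lt_of_le_of_ne (Nat.lt_succ_iff.1 h) fun h => h' (Fin.ext h)
  unfold gjStep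
  split_ifs with hper
  · exact
    { injective := H.injective
      length_le := H.length_le
      pivots_lt := fun p hp => (H.pivots_lt p hp).trans (Nat.lt_succ_self _)
      pivots_sorted := H.pivots_sorted
      basic_lt := fun p hp => (H.basic_lt p hp).trans (Nat.lt_succ_self _)
      basic_sorted := H.basic_sorted
      basic_modNat := H.basic_modNat
      apply_pivot := H.apply_pivot
      apply_basic := H.apply_basic
      covers := fun c' hc' => by
        by_cases h : c' = c
        · subst h
          obtain ⟨q, hq, hmod⟩ := hper
          exact Or.inr ⟨q, hq, Fin.le_def.2 (H.basic_lt q hq).le, hmod⟩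
        · exact H.covers c' (hcov c' hc' h) }
  · push Not at hper
    dsimp only
    split
    next hnone =>
      have hzero := rule.eq_zero_of_pick_eq_none _ _ hnone
      exact
      { injective := H.injective
        length_le := H.length_le
        pivots_lt := fun p hp => (H.pivots_lt p hp).trans (Nat.lt_succ_self _)
        pivots_sorted := H.pivots_sorted
        basic_lt := fun q hq => by
          rcases List.mem_append.1 hq with hq | hq
          · exact (H.basic_lt q hq).trans (Nat.lt_succ_self _)
          · rw [List.mem_singleton.1 hq]
            exact Nat.lt_succ_self _
        basic_sorted := List.pairwise_append.2 ⟨H.basic_sorted, List.pairwise_singleton _ _,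
          fun q hq q' hq' => by
            rw [List.mem_singleton.1 hq']
            exact H.basic_lt q hq⟩
        basic_modNat := List.pairwise_append.2 ⟨H.basic_modNat, List.pairwise_singleton _ _,
          fun q hq q' hq' => by
            rw [List.mem_singleton.1 hq']
            exact hper q hq⟩
        apply_pivot := H.apply_pivot
        -- For the new basic column, a nonzero entry must lie in a pivot row, and every pivot found
        -- so far precedes the column.
        apply_basic := fun q hq r hr => by
          rcases List.mem_append.1 hq with hq | hq
          · exact H.apply_basic q hq r hr
          · rw [List.mem_singleton.1 hq] at hr ⊢
            have h : (r : ℕ) < st.pivots.length := not_le.1 fun h => hr (hzero r h)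
            exact ⟨h, H.pivots_lt _ (List.getElem_mem h)⟩
        covers := fun c' hc' => by
          by_cases h : c' = c
          · exact Or.inr ⟨c, by simp, h.ge, by rw [h]⟩
          · refine (H.covers c' (hcov c' hc' h)).imp_right ?_
            rintro ⟨q, hq, h'⟩
            exact ⟨q, List.mem_append_left _ hq, h'⟩ }
    next i hsome =>
      obtain ⟨i, hri, hvi⟩ := i
      have hlt : st.pivots.length < m := lt_of_le_of_lt hri i.isLt
      have hle : (⟨st.pivots.length, hlt⟩ : Fin m) ≤ i := hri
      exact
      { injective := by
          intro x y hxy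
          simp only [applyOps_append] at hxy
          exact H.injective (applyOps_pivotOps_injective hvi _ hxy)
        length_le := by
          rw [List.length_append, List.length_singleton]
          exact hlt
        pivots_lt := fun q hq => by
          rcases List.mem_append.1 hq with hq | hq
          · exact (H.pivots_lt q hq).trans (Nat.lt_succ_self _)
          · rw [List.mem_singleton.1 hq]
            exact Nat.lt_succ_self _
        pivots_sorted := List.pairwise_append.2 ⟨H.pivots_sorted, List.pairwise_singleton _ _,
          fun q hq q' hq' => by
            rw [List.mem_singleton.1 hq']
            exact H.pivots_lt q hq⟩
        basic_lt := fun p hp => (H.basic_lt p hp).trans (Nat.lt_succ_self _)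
        basic_sorted := H.basic_sorted
        basic_modNat := H.basic_modNat
        apply_pivot := fun j hj hm => by
          simp only [applyOps_append]
          rw [List.length_append, List.length_singleton] at hj
          rcases (Nat.lt_succ_iff.1 hj).lt_or_eq with hj' | rfl
          · rw [List.getElem_append_left hj', H.apply_pivot j hj' hm]
            refine applyOps_pivotOps_of_eq_zero _ hle fun k hk => Pi.single_eq_of_ne ?_ _
            rintro rfl
            exact absurd (Fin.le_def.1 hk) (not_le.2 hj')
          · rw [List.getElem_concat_length rfl]
            exact applyOps_pivotOps_self hvi _
        apply_basic := fun q hq r hr => by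
          simp only [applyOps_append] at hr
          rw [applyOps_pivotOps_of_eq_zero _ hle fun k hk => by
            by_contra h0
            obtain ⟨h, -⟩ := H.apply_basic q hq k h0
            exact absurd (Fin.le_def.1 hk) (not_le.2 h)] at hr
          obtain ⟨h, h'⟩ := H.apply_basic q hq r hr
          refine ⟨by rw [List.length_append]; omega, ?_⟩
          simpa only [Fin.getElem_fin, List.getElem_append_left h] using h'
        covers := fun c' hc' => by
          by_cases h : c' = c
          · exact Or.inl (by simp [h])
          · exact (H.covers c' (hcov c' hc' h)).imp_left (List.mem_append_left _) }

theorem gjInvariant_foldl_take [DecidableEq K] (A : Matrix (Fin m) (Fin (b * n)) K)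
    (rule : PivotRule K m) (k : ℕ) (hk : k ≤ b * n) :
    GJInvariant A (((List.finRange (b * n)).take k).foldl (gjStep rule A) ⟨[], [], []⟩) k := by
  induction k with
  | zero =>
    exact
    { injective := fun _ _ h => h
      length_le := Nat.zero_le _
      pivots_lt := by simp
      pivots_sorted := List.Pairwise.nil
      basic_lt := by simp
      basic_sorted := List.Pairwise.nil
      basic_modNat := List.Pairwise.nil
      apply_pivot := by simp
      apply_basic := by simp
      covers := by simp }
  | succ k ih =>
    have h := List.take_succ_eq_append_getElem (l := List.finRange (b * n)) (i := k)
      (by rw [List.length_finRange]; exact hk)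
    rw [h, List.foldl_append, List.foldl_cons, List.foldl_nil, List.getElem_finRange]
    exact GJInvariant.step ⟨k, hk⟩ (ih (Nat.le_of_succ_le hk)) rule

theorem gjInvariant_gaussJordan [DecidableEq K] (A : Matrix (Fin m) (Fin (b * n)) K)
    (rule : PivotRule K m) : GJInvariant A (gaussJordan rule A) (b * n) := by
  have h := gjInvariant_foldl_take A rule (b * n) le_rfl
  rwa [List.take_of_length_le (by rw [List.length_finRange])] at h

end Elimination

/-! ### Bézout's identity with degree bounds -/

section Bezout

variable {K : Type*} [Field K] {n : ℕ}

theorem IsMonicGcd.exists_dotProduct_eq_one {a : Fin n → K[X]} (ha : IsMonicGcd a 1) :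
    ∃ h : Fin n → K[X], a ⬝ᵥ h = 1 := by
  obtain ⟨g, hg⟩ := (IsPrincipalIdealRing.principal (Ideal.span (Set.range a))).principal
  have hdvd : ∀ i, g ∣ a i := fun i => by
    rw [← Ideal.mem_span_singleton]
    change a i ∈ Submodule.span K[X] {g}
    rw [← hg]
    exact Ideal.subset_span ⟨i, rfl⟩
  have h1 : (1 : K[X]) ∈ Ideal.span (Set.range a) := by
    rw [hg]
    exact Ideal.mem_span_singleton.2 (ha.2.2 g hdvd)
  obtain ⟨h, hh⟩ := (Ideal.mem_span_range_iff_exists_fun).1 h1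
  exact ⟨h, by simpa [dotProduct, mul_comm] using hh⟩

theorem IsMonicGcd.ne_zero {a : Fin n → K[X]} (ha : IsMonicGcd a 1) : a ≠ 0 := by
  rintro rfl
  obtain ⟨h, hh⟩ := ha.exists_dotProduct_eq_one
  simp at hh

theorem vecDegree_eq_vecNatDegree {a : Fin n → K[X]} (ha : a ≠ 0) :
    vecDegree a = (vecNatDegree a : WithBot ℕ) := by
  have h : vecDegree a ≠ ⊥ := by
    simpa [vecDegree, Finset.sup_eq_bot_iff, funext_iff] using ha
  obtain ⟨k, hk⟩ := WithBot.ne_bot_iff_exists.1 h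
  rw [vecNatDegree, ← hk]
  rfl

theorem degree_le_vecNatDegree {a : Fin n → K[X]} (ha : a ≠ 0) (i : Fin n) :
    (a i).degree ≤ (vecNatDegree a : WithBot ℕ) :=
  (Finset.le_sup (f := fun i => (a i).degree) (Finset.mem_univ i)).trans
    (vecDegree_eq_vecNatDegree ha).le

theorem exists_degree_eq_vecNatDegree [NeZero n] {a : Fin n → K[X]} (ha : a ≠ 0) :
    ∃ i, (a i).degree = (vecNatDegree a : WithBot ℕ) := by
  obtain ⟨i, -, hi⟩ := Finset.exists_mem_eq_sup Finset.univ ⟨0, Finset.mem_univ _⟩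
    fun i => (a i).degree
  exact ⟨i, hi.symm.trans (vecDegree_eq_vecNatDegree ha)⟩

/-- Pick `a i₀` of degree `d` and reduce all other components of a solution modulo `a i₀`, moving
the quotients into component `i₀`. The degree of that component is then forced by the equation. -/
theorem IsMonicGcd.exists_dotProduct_eq [NeZero n] {a : Fin n → K[X]} (ha : IsMonicGcd a 1)
    {e : ℕ} {f : K[X]} (hf : f.degree < (2 * vecNatDegree a + e : ℕ)) :
    ∃ h : Fin n → K[X], a ⬝ᵥ h = f ∧ ∀ i, (h i).degree < (vecNatDegree a + e : ℕ) := by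
  obtain ⟨h₀, hh₀⟩ := ha.exists_dotProduct_eq_one
  obtain ⟨i₀, hi₀⟩ := exists_degree_eq_vecNatDegree ha.ne_zero
  set d := vecNatDegree a with hd
  have hg0 : a i₀ ≠ 0 := fun h => by simp [h] at hi₀
  set t : K[X] := ∑ i ∈ Finset.univ.erase i₀, a i * (f * h₀ i % a i₀) with ht
  set z : K[X] := f * h₀ i₀ + ∑ i ∈ Finset.univ.erase i₀, a i * (f * h₀ i / a i₀) with hz
  have hmod : ∀ i, (f * h₀ i % a i₀).degree < (d : WithBot ℕ) := fun i => by
    rw [← hi₀]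
    exact degree_mod_lt _ hg0
  have hsum : a i₀ * z + t = f := by
    have h1 : ∀ i, a i * (f * h₀ i) =
        a i₀ * (a i * (f * h₀ i / a i₀)) + a i * (f * h₀ i % a i₀) := fun i => by
      conv_lhs => rw [← EuclideanDomain.div_add_mod (f * h₀ i) (a i₀)]
      ring
    have h2 : f = ∑ i, a i * (f * h₀ i) := by
      conv_lhs => rw [← mul_one f, ← hh₀, dotProduct, Finset.mul_sum]
      exact Finset.sum_congr rfl fun i _ => by ring
    rw [← Finset.add_sum_erase _ _ (Finset.mem_univ i₀), Finset.sum_congr rfl fun i _ => h1 i,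
      Finset.sum_add_distrib, ← Finset.mul_sum] at h2
    conv_rhs => rw [h2]
    rw [hz, ht]
    ring
  have htd : t.degree < (2 * d + e : ℕ) := by
    refine (degree_sum_le _ _).trans_lt ((Finset.sup_lt_iff (WithBot.bot_lt_coe _)).2 ?_)
    intro i _
    rw [degree_mul]
    by_cases h0 : f * h₀ i % a i₀ = 0
    · rw [h0, degree_zero, WithBot.add_bot]
      exact WithBot.bot_lt_coe _
    · have h1 := hmod i
      have h2 := degree_le_vecNatDegree ha.ne_zero i
      rw [degree_eq_natDegree h0] at h1 ⊢
      have h1 : (f * h₀ i % a i₀).natDegree < d := by exact_mod_cast h1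
      refine (add_le_add_left h2 _).trans_lt ?_
      rw [← hd]
      norm_cast
      omega
  refine ⟨fun i => if i = i₀ then z else f * h₀ i % a i₀, ?_, fun i => ?_⟩
  · rw [dotProduct, ← Finset.add_sum_erase _ _ (Finset.mem_univ i₀), if_pos rfl,
      Finset.sum_congr rfl fun i hi => by rw [if_neg (Finset.ne_of_mem_erase hi)]]
    exact hsum
  · by_cases hi : i = i₀
    · simp only [hi, if_true]
      have h1 : (a i₀ * z).degree < (2 * d + e : ℕ) := by
        rw [← eq_sub_iff_add_eq] at hsum
        rw [hsum]
        exact (degree_sub_le _ _).trans_lt (max_lt hf htd)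
      rw [degree_mul, hi₀] at h1
      by_cases h0 : z = 0
      · rw [h0, degree_zero]
        exact WithBot.bot_lt_coe _
      · rw [degree_eq_natDegree h0] at h1 ⊢
        norm_cast at h1 ⊢
        omega
    · simp only [hi, if_false]
      refine (hmod i).trans_le ?_
      norm_cast
      omega

end Bezout

/-! ### Columns of `A` as polynomials -/

section Columns

variable {K : Type*} [Field K] {n : ℕ} [NeZero n]

/-- The product of `a` with the monomial vector of flat index `c`. -/
noncomputable def colPoly (a : Fin n → K[X]) (c : ℕ) : K[X] := a (position n c) * X ^ (c / n)

/-- The vector of the first `m` coefficients. -/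
noncomputable def toVec (K : Type*) [Field K] (m : ℕ) : K[X] →ₗ[K] Fin m → K :=
  LinearMap.pi fun i => lcoeff K i

theorem dotProduct_monoVec (a : Fin n → K[X]) (c : ℕ) : a ⬝ᵥ monoVec K n c = colPoly a c := by
  rw [monoVec, dotProduct_single, colPoly]

theorem eq_sum_monoVec {h : Fin n → K[X]} {B : ℕ} (hB : ∀ c, B ≤ c → coef h c = 0) :
    h = ∑ c ∈ Finset.range B, C (coef h c) • monoVec K n c := by
  refine coef_ext fun c => ?_
  simp only [coef_sum, coef_C_smul, coef_monoVec, mul_ite, mul_one, mul_zero,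
    Finset.sum_ite_eq, Finset.mem_range]
  split_ifs with hc
  · rfl
  · exact hB c (not_lt.1 hc)

theorem dotProduct_eq_sum (a : Fin n → K[X]) {h : Fin n → K[X]} {B : ℕ}
    (hB : ∀ c, B ≤ c → coef h c = 0) :
    a ⬝ᵥ h = ∑ c ∈ Finset.range B, coef h c • colPoly a c := by
  conv_lhs => rw [eq_sum_monoVec hB]
  rw [dotProduct_sum]
  refine Finset.sum_congr rfl fun c _ => ?_
  rw [dotProduct_smul, dotProduct_monoVec, smul_eq_mul, smul_eq_C_mul]

theorem colPoly_add_mul (a : Fin n → K[X]) (c k : ℕ) :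
    colPoly a (c + n * k) = X ^ k * colPoly a c := by
  have h1 : position n (c + n * k) = position n c := Fin.ext (by simp [position])
  rw [colPoly, h1, Nat.add_mul_div_left _ _ (NeZero.pos n), pow_add, colPoly]
  ring

theorem sylvesterMatrix_col (a : Fin n → K[X]) (c : Fin ((vecNatDegree a + 1) * n)) :
    (sylvesterMatrix a).col c = toVec K (2 * vecNatDegree a + 1) (colPoly a c) := by
  funext i
  change _ = (colPoly a c).coeff i
  rw [colPoly, coeff_mul_X_pow']
  rfl

/-- The `2d + 1` rows of `A` therefore lose no coefficient, and `toVec` is faithful on the columns.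
-/
theorem colPoly_mem_degreeLT {a : Fin n → K[X]} (ha : a ≠ 0) {c : ℕ}
    (hc : c < (vecNatDegree a + 1) * n) : colPoly a c ∈ degreeLT K (2 * vecNatDegree a + 1) := by
  rw [mem_degreeLT, colPoly, degree_mul, degree_X_pow]
  refine (add_le_add_left (degree_le_vecNatDegree ha _) _).trans_lt ?_
  have := (Nat.div_lt_iff_lt_mul (NeZero.pos n)).2 hc
  norm_cast
  omega

theorem eq_of_toVec_eq {m : ℕ} {f g : K[X]} (hf : f ∈ degreeLT K m) (hg : g ∈ degreeLT K m)
    (h : toVec K m f = toVec K m g) : f = g := by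
  ext k
  by_cases hk : k < m
  · exact congrFun h ⟨k, hk⟩
  · rw [mem_degreeLT] at hf hg
    have hk : (m : WithBot ℕ) ≤ k := by exact_mod_cast not_lt.1 hk
    rw [coeff_eq_zero_of_degree_lt (hf.trans_le hk), coeff_eq_zero_of_degree_lt (hg.trans_le hk)]

variable {a : Fin n → K[X]}
  {st : GJState K (2 * vecNatDegree a + 1) ((vecNatDegree a + 1) * n)}

/-- The pivotal indices as natural numbers. -/
def pivotSet (st : GJState K (2 * vecNatDegree a + 1) ((vecNatDegree a + 1) * n)) : Finset ℕ :=
  (st.pivots.map Fin.val).toFinset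

/-- The span of the pivotal columns before `c`. -/
noncomputable def pivotSpan (a : Fin n → K[X])
    (st : GJState K (2 * vecNatDegree a + 1) ((vecNatDegree a + 1) * n)) (c : ℕ) :
    Submodule K K[X] :=
  Submodule.span K (colPoly a '' {p | p ∈ pivotSet st ∧ p < c})

omit [NeZero n] in
theorem mem_pivotSet {p : Fin ((vecNatDegree a + 1) * n)} :
    (p : ℕ) ∈ pivotSet st ↔ p ∈ st.pivots := by
  simp [pivotSet, Fin.val_inj]

omit [NeZero n] in
theorem lt_of_mem_pivotSet {p : ℕ} (hp : p ∈ pivotSet st) : p < (vecNatDegree a + 1) * n := by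
  obtain ⟨x, -, rfl⟩ := List.mem_map.1 (List.mem_toFinset.1 hp)
  exact x.isLt

theorem pivotSpan_mono {c c' : ℕ} (h : c ≤ c') : pivotSpan a st c ≤ pivotSpan a st c' :=
  Submodule.span_mono (Set.image_mono fun _ hp => ⟨hp.1, hp.2.trans_le h⟩)

/-! ### Pivots, rank and syzygies -/

namespace GJInvariant

variable (H : GJInvariant (sylvesterMatrix a) st ((vecNatDegree a + 1) * n))

include H

omit [NeZero n] in
theorem card_pivotSet : (pivotSet st).card = st.pivots.length := by
  rw [pivotSet, List.toFinset_card_of_nodup, List.length_map]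
  exact (List.nodup_map_iff Fin.val_injective).2 (H.pivots_sorted.imp fun h => h.ne)

/-- A vector of degree at most `2 d` is recovered from its reduction, if this is supported on the
pivot rows. -/
theorem eq_sum_pivots (ha : a ≠ 0) {f : K[X]} (hf : f ∈ degreeLT K (2 * vecNatDegree a + 1))
    (hsupp : ∀ i : Fin (2 * vecNatDegree a + 1), st.pivots.length ≤ i →
      applyOps st.ops (toVec K _ f) i = 0) :
    f = ∑ i : Fin (2 * vecNatDegree a + 1), if h : (i : ℕ) < st.pivots.length then
      applyOps st.ops (toVec K _ f) i • colPoly a st.pivots[i] else 0 := by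
  apply eq_of_toVec_eq hf
  · refine Submodule.sum_mem _ fun i _ => ?_
    split_ifs with h
    · exact Submodule.smul_mem _ _ (colPoly_mem_degreeLT ha (Fin.isLt _))
    · exact Submodule.zero_mem _
  apply H.injective
  let T := (isLinearMap_applyOps st.ops).mk'
  change _ = T (toVec K _ _)
  rw [map_sum, map_sum]
  have key : ∀ i : Fin (2 * vecNatDegree a + 1), T (toVec K _
      (if h : (i : ℕ) < st.pivots.length then
        applyOps st.ops (toVec K _ f) i • colPoly a st.pivots[i] else 0)) =
      Pi.single i (applyOps st.ops (toVec K _ f) i) := fun i => by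
    split_ifs with h
    · rw [map_smul, map_smul, Fin.getElem_fin, ← sylvesterMatrix_col]
      change _ • applyOps st.ops _ = _
      rw [H.apply_pivot i h i.isLt, ← Pi.single_smul, smul_eq_mul, mul_one]
    · rw [hsupp i (not_lt.1 h), map_zero, map_zero, Pi.single_zero]
  rw [Finset.sum_congr rfl fun i _ => key i, Finset.univ_sum_single]

theorem colPoly_basic_mem (ha : a ≠ 0) {q : Fin ((vecNatDegree a + 1) * n)}
    (hq : q ∈ st.basic) : colPoly a q ∈ pivotSpan a st q := by
  rw [H.eq_sum_pivots ha (colPoly_mem_degreeLT ha q.isLt) fun i hi => by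
    by_contra h0
    rw [← sylvesterMatrix_col] at h0
    obtain ⟨h, -⟩ := H.apply_basic q hq i h0
    omega]
  refine Submodule.sum_mem _ fun i _ => ?_
  split_ifs with h
  · by_cases h0 : applyOps st.ops (toVec K _ (colPoly a q)) i = 0
    · rw [h0, zero_smul]
      exact Submodule.zero_mem _
    · refine Submodule.smul_mem _ _ (Submodule.subset_span ⟨_, ⟨?_, ?_⟩, rfl⟩)
      · exact mem_pivotSet.2 (List.getElem_mem h)
      · rw [← sylvesterMatrix_col] at h0
        obtain ⟨h', hlt⟩ := H.apply_basic q hq i h0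
        exact hlt
  · exact Submodule.zero_mem _

/-- A non-pivotal column is a shift of a basic one by some `X ^ k`. Shifting the relation of the
basic column gives earlier columns, which are pivotal or covered by induction. -/
theorem colPoly_mem (ha : a ≠ 0) (c : ℕ) (hc : c < (vecNatDegree a + 1) * n)
    (hp : c ∉ pivotSet st) : colPoly a c ∈ pivotSpan a st c := by
  induction c using Nat.strong_induction_on with
  | _ c ih =>
    rcases H.covers ⟨c, hc⟩ hc with h | ⟨q, hq, hle, hmod⟩
    · exact absurd (mem_pivotSet.2 h) hp
    have hmod : (q : ℕ) % n = c % n := congrArg Fin.val hmod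
    have hle : (q : ℕ) ≤ c := hle
    obtain ⟨k, hk⟩ := (Nat.modEq_iff_dvd' hle).1 hmod
    have hck : c = q + n * k := by omega
    have h1 : pivotSpan a st q ≤ (pivotSpan a st c).comap (LinearMap.mulLeft K (X ^ k)) := by
      refine Submodule.span_le.2 ?_
      rintro _ ⟨p, ⟨hp, hpq⟩, rfl⟩
      change X ^ k * colPoly a p ∈ pivotSpan a st c
      rw [← colPoly_add_mul]
      have hlt : p + n * k < c := by omega
      by_cases hpk : p + n * k ∈ pivotSet st
      · exact Submodule.subset_span ⟨_, ⟨hpk, hlt⟩, rfl⟩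
      · exact pivotSpan_mono hlt.le (ih _ hlt (hlt.trans hc) hpk)
    rw [show colPoly a c = X ^ k * colPoly a q by rw [hck, colPoly_add_mul]]
    exact h1 (H.colPoly_basic_mem ha hq)

theorem colPoly_mem_of_lt (ha : a ≠ 0) {c e : ℕ} (hc : c < (vecNatDegree a + 1) * n)
    (hce : c < e) : colPoly a c ∈ pivotSpan a st e := by
  by_cases hp : c ∈ pivotSet st
  · exact Submodule.subset_span ⟨c, ⟨hp, hce⟩, rfl⟩
  · exact pivotSpan_mono hce.le (H.colPoly_mem ha c hc hp)

/-- The coordinate of the reduction in the pivot row of `p` is `1` on column `p` and `0` on every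
other pivotal column. -/
theorem colPoly_pivot_notMem {p : ℕ} (hp : p ∈ pivotSet st) :
    colPoly a p ∉ pivotSpan a st p := by
  obtain ⟨x, hx, rfl⟩ := List.mem_map.1 (List.mem_toFinset.1 hp)
  obtain ⟨i, hi, rfl⟩ := List.getElem_of_mem hx
  have him := hi.trans_le H.length_le
  let T := (isLinearMap_applyOps st.ops).mk'
  have h1 : ∀ j (hj : j < st.pivots.length),
      (LinearMap.proj ⟨i, him⟩ ∘ₗ T ∘ₗ toVec K _) (colPoly a st.pivots[j]) =
        if j = i then 1 else 0 := fun j hj => by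
    change applyOps st.ops (toVec K _ (colPoly a st.pivots[j])) ⟨i, him⟩ = _
    rw [← sylvesterMatrix_col, H.apply_pivot j hj (hj.trans_le H.length_le), Pi.single_apply]
    simp [Fin.ext_iff, eq_comm]
  have h2 : pivotSpan a st st.pivots[i] ≤
      LinearMap.ker (LinearMap.proj ⟨i, him⟩ ∘ₗ T ∘ₗ toVec K _) := by
    refine Submodule.span_le.2 ?_
    rintro _ ⟨p, ⟨hp, hlt⟩, rfl⟩
    obtain ⟨y, hy, rfl⟩ := List.mem_map.1 (List.mem_toFinset.1 hp)
    obtain ⟨j, hj, rfl⟩ := List.getElem_of_mem hy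
    have hji : j ≠ i := by
      rintro rfl
      exact lt_irrefl _ hlt
    exact (h1 j hj).trans (if_neg hji)
  intro hmem
  have h3 := LinearMap.mem_ker.1 (h2 hmem)
  rw [h1 i hi, if_pos rfl] at h3
  exact one_ne_zero h3

/-- A syzygy with lead `c` expresses column `c` through earlier columns, hence through earlier
pivotal ones. -/
theorem lead_notMem_pivotSet (ha : a ≠ 0) {h : Fin n → K[X]} {c : ℕ} (h0 : a ⬝ᵥ h = 0)
    (hc : IsLead h c) : c ∉ pivotSet st := by
  intro hp
  refine H.colPoly_pivot_notMem hp ?_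
  have h1 := dotProduct_eq_sum a (h := h) (B := c + 1) fun c' hc' => hc.2 c' hc'
  rw [h0, Finset.sum_range_succ, eq_comm, add_eq_zero_iff_eq_neg, eq_comm,
    neg_eq_iff_eq_neg] at h1
  rw [← inv_smul_smul₀ hc.1 (colPoly a c), h1]
  refine Submodule.smul_mem _ _ (Submodule.neg_mem _ (Submodule.sum_mem _ fun x hx => ?_))
  have hx := Finset.mem_range.1 hx
  exact Submodule.smul_mem _ _ (H.colPoly_mem_of_lt ha (hx.trans (lt_of_mem_pivotSet hp)) hx)

/-- By the bounded Bézout identity the first `d + e` blocks generate all polynomials of degree less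
than `2d + e`, and their pivotal columns suffice. Used with `e = 1` for the full rank and `e = 0`
for the pivots outside the last block. -/
theorem le_card_filter_pivotSet (ha : IsMonicGcd a 1) {e : ℕ} (he : e ≤ 1) :
    2 * vecNatDegree a + e ≤
      ((pivotSet st).filter (· < (vecNatDegree a + e) * n)).card := by
  classical
  set s := (pivotSet st).filter (· < (vecNatDegree a + e) * n) with hs
  have hle : degreeLT K (2 * vecNatDegree a + e) ≤
      Submodule.span K ((s.image (colPoly a) : Finset _) : Set K[X]) := by
    intro f hf
    obtain ⟨h, rfl, hh⟩ := ha.exists_dotProduct_eq (mem_degreeLT.1 hf)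
    have hB : ∀ c, (vecNatDegree a + e) * n ≤ c → coef h c = 0 := fun c hc => by
      apply coeff_eq_zero_of_degree_lt ((hh _).trans_le _)
      exact_mod_cast (Nat.le_div_iff_mul_le (NeZero.pos n)).2 hc
    rw [dotProduct_eq_sum a hB]
    have hset : ((s.image (colPoly a) : Finset _) : Set K[X]) =
        colPoly a '' {p | p ∈ pivotSet st ∧ p < (vecNatDegree a + e) * n} := by
      simp [hs]
    rw [hset]
    refine Submodule.sum_mem _ fun c hc => Submodule.smul_mem _ _ ?_
    have hc := Finset.mem_range.1 hc
    exact H.colPoly_mem_of_lt ha.ne_zero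
      (hc.trans_le (Nat.mul_le_mul_right n (Nat.add_le_add_left he _))) hc
  have h1 := Submodule.finrank_mono hle
  rw [(degreeLTEquiv K (2 * vecNatDegree a + e)).finrank_eq, Module.finrank_fin_fun] at h1
  exact h1.trans ((finrank_span_finset_le_card _).trans Finset.card_image_le)

theorem length_pivots (ha : IsMonicGcd a 1) :
    st.pivots.length = 2 * vecNatDegree a + 1 := by
  refine le_antisymm H.length_le ?_
  rw [← H.card_pivotSet]
  exact (H.le_card_filter_pivotSet ha le_rfl).trans (Finset.card_filter_le _ _)

/-- A residue class without basic index has a pivot in the last block. Of the `2d + 1` pivots at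
least `2d` lie before that block, so at most one class is of this kind. -/
theorem le_length_basic (ha : IsMonicGcd a 1) : n ≤ st.basic.length + 1 := by
  classical
  set R : Finset (Fin n) := (st.basic.map Fin.modNat).toFinset with hR
  have h1 : R.card ≤ st.basic.length :=
    (List.toFinset_card_le _).trans (List.length_map _).le
  have h2 : Rᶜ.card ≤ ((pivotSet st).filter (¬ · < (vecNatDegree a + 0) * n)).card := by
    refine Finset.card_le_card_of_injOn (fun r : Fin n => (r : ℕ) + n * vecNatDegree a) ?_ ?_
    · intro r hr
      have hr : r ∉ R := by simpa using hr
      have hlt : (r : ℕ) + n * vecNatDegree a < (vecNatDegree a + 1) * n := by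
        rw [add_mul, mul_comm, one_mul, add_comm]
        exact Nat.add_lt_add_left r.isLt _
      simp only [Finset.coe_filter, Set.mem_ofPred_eq]
      refine ⟨?_, ?_⟩
      · rcases H.covers ⟨_, hlt⟩ hlt with h | ⟨q, hq, -, hmod⟩
        · exact mem_pivotSet.2 h
        · refine absurd ?_ hr
          rw [hR, List.mem_toFinset, List.mem_map]
          refine ⟨q, hq, hmod.trans (Fin.ext ?_)⟩
          simp [Fin.modNat, Nat.mod_eq_of_lt r.isLt]
      · rw [add_zero, mul_comm, not_lt]
        exact Nat.le_add_left _ _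
    · intro r _ r' _ h
      exact Fin.ext (Nat.add_right_cancel h)
  have h3 := H.le_card_filter_pivotSet ha (e := 0) (Nat.zero_le _)
  have h4 := Finset.card_filter_add_card_filter_not (s := pivotSet st)
    (· < (vecNatDegree a + 0) * n)
  rw [H.card_pivotSet, H.length_pivots ha] at h4
  rw [Finset.card_compl, Fintype.card_fin] at h2
  omega

/-- The syzygy given by a basic non-pivotal column. -/
theorem isLead_dotProduct_basic (ha : IsMonicGcd a 1) {q : Fin ((vecNatDegree a + 1) * n)}
    (hq : q ∈ st.basic) {u : Fin n → K[X]}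
    (hu : u = monoVec K n q - ∑ i : Fin (2 * vecNatDegree a + 1),
      C (applyOps st.ops ((sylvesterMatrix a).col q) i) •
        monoVec K n (st.pivots[i]'(i.isLt.trans_eq (H.length_pivots ha).symm))) :
    IsLead u q ∧ a ⬝ᵥ u = 0 := by
  -- Pivotal monomials entering with a nonzero coefficient lie strictly below `q`.
  have hcoef : ∀ c : ℕ, q ≤ c → coef u c = if c = q then 1 else 0 := fun c hc => by
    rw [hu, coef_sub, coef_sum, coef_monoVec, sub_eq_self]
    refine Finset.sum_eq_zero fun i _ => ?_
    rw [coef_C_smul, coef_monoVec]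
    by_cases h0 : applyOps st.ops ((sylvesterMatrix a).col q) i = 0
    · rw [h0, zero_mul]
    · obtain ⟨h, hlt⟩ := H.apply_basic q hq i h0
      have hlt : (st.pivots[i] : ℕ) < q := hlt
      rw [if_neg (by omega), mul_zero]
  refine ⟨⟨?_, fun c hc => ?_⟩, ?_⟩
  · rw [hcoef q le_rfl, if_pos rfl]
    exact one_ne_zero
  · rw [hcoef c hc.le, if_neg hc.ne']
  · rw [hu, dotProduct_sub, dotProduct_monoVec, dotProduct_sum, sub_eq_zero]
    -- Every row is a pivot row, so the support condition is vacuous.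
    conv_lhs => rw [H.eq_sum_pivots ha.ne_zero (colPoly_mem_degreeLT ha.ne_zero q.isLt)
      fun i hi => absurd (hi.trans_lt i.isLt) (by rw [H.length_pivots ha]; exact lt_irrefl _)]
    refine Finset.sum_congr rfl fun i _ => ?_
    rw [dif_pos (i.isLt.trans_eq (H.length_pivots ha).symm), dotProduct_smul, dotProduct_monoVec,
      sylvesterMatrix_col, smul_eq_mul, smul_eq_C_mul]

/-- The preimage of `1` given by the last column. -/
theorem dotProduct_last (ha : IsMonicGcd a 1) :
    a ⬝ᵥ (∑ i : Fin (2 * vecNatDegree a + 1),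
      C (applyOps st.ops (Pi.single 0 1) i) •
        monoVec K n (st.pivots[i]'(i.isLt.trans_eq (H.length_pivots ha).symm))) = 1 := by
  have h1 : (1 : K[X]) ∈ degreeLT K (2 * vecNatDegree a + 1) := by
    rw [mem_degreeLT, degree_one]
    exact_mod_cast Nat.succ_pos _
  have h2 : toVec K (2 * vecNatDegree a + 1) 1 = Pi.single 0 1 := by
    funext i
    change (1 : K[X]).coeff i = _
    rw [coeff_one, Pi.single_apply]
    simp only [Fin.ext_iff, Fin.val_zero]
  conv_rhs => rw [H.eq_sum_pivots ha.ne_zero h1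
      fun i hi => absurd (hi.trans_lt i.isLt) (by rw [H.length_pivots ha]; exact lt_irrefl _)]
  rw [dotProduct_sum]
  refine Finset.sum_congr rfl fun i _ => ?_
  rw [dif_pos (i.isLt.trans_eq (H.length_pivots ha).symm), dotProduct_smul, dotProduct_monoVec,
    h2, smul_eq_mul, smul_eq_C_mul]

omit [NeZero n] in
theorem eq_of_modNat_eq {q q' : Fin ((vecNatDegree a + 1) * n)} (hq : q ∈ st.basic)
    (hq' : q' ∈ st.basic) (h : q.modNat = q'.modNat) : q = q' := by
  by_contra hne
  have : Std.Symm fun q q' : Fin ((vecNatDegree a + 1) * n) => q.modNat ≠ q'.modNat :=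
    ⟨fun _ _ h => h.symm⟩
  exact H.basic_modNat.forall hq hq' hne h

/-- With `n` basic indices there would be `n` syzygies with leads in distinct classes. -/
theorem length_basic (ha : IsMonicGcd a 1) : st.basic.length + 1 = n := by
  refine le_antisymm ?_ (H.le_length_basic ha)
  by_contra! hlt
  have hi : ∀ i : Fin n, (i : ℕ) < st.basic.length := fun i => by
    have := i.isLt
    omega
  have h := fun i : Fin n => H.isLead_dotProduct_basic ha (List.getElem_mem (hi i)) rfl
  refine not_isLead_of_syzygies ha.ne_zero (fun i => (h i).1) (fun i j hij => ?_) fun i => (h i).2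
  have h1 := H.eq_of_modNat_eq (List.getElem_mem (hi i)) (List.getElem_mem (hi j)) (Fin.ext hij)
  have hnd : st.basic.Nodup := H.basic_sorted.imp fun h => h.ne
  exact Fin.ext ((hnd.getElem_inj_iff).1 h1)

end GJInvariant

end Columns

/-! ### The output is a reduced frame -/

section Output

variable {K : Type*} [Field K]

theorem col_sum_map {ι n : Type*} [DecidableEq n] {R : Type*} [Semiring R] (l : List ι)
    (M : ι → Matrix n n R) (j : n) : (l.map M).sum.col j = (l.map fun t => (M t).col j).sum := by
  induction l with
  | nil => rfl
  | cons t l ih =>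
    rw [List.map_cons, List.map_cons, List.sum_cons, List.sum_cons, ← ih]
    rfl

theorem col_single {n : Type*} [DecidableEq n] {R : Type*} [Zero R] (i j k : n) (x : R) :
    (Matrix.single i j x).col k = if j = k then Pi.single i x else 0 := by
  funext r
  by_cases h : j = k
  · subst h
    simp [Matrix.col, Matrix.single_apply, Pi.single_apply, eq_comm]
  · simp [Matrix.col, h]

theorem sum_map_ite_eq_zero {ι κ M : Type*} [DecidableEq κ] [AddMonoid M] {l : List (κ × ι)}
    (f : κ × ι → M) {j : κ} (hj : j ∉ l.map Prod.fst) :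
    (l.map fun t => if t.1 = j then f t else 0).sum = 0 := by
  apply List.sum_eq_zero
  intro x hx
  obtain ⟨t, ht, rfl⟩ := List.mem_map.1 hx
  exact if_neg fun h => hj (List.mem_map.2 ⟨t, ht, h⟩)

theorem sum_map_ite_eq {ι κ M : Type*} [DecidableEq κ] [AddMonoid M] {l : List (κ × ι)}
    (hl : (l.map Prod.fst).Nodup) (f : κ × ι → M) {s : κ × ι} (hs : s ∈ l) :
    (l.map fun t => if t.1 = s.1 then f t else 0).sum = f s := by
  induction l with
  | nil => simp at hs
  | cons t l ih =>
    rw [List.map_cons, List.nodup_cons] at hl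
    rw [List.map_cons, List.sum_cons]
    rcases List.mem_cons.1 hs with rfl | hs
    · rw [if_pos rfl, sum_map_ite_eq_zero f hl.1, add_zero]
    · rw [ih hl.2 hs, if_neg, zero_add]
      intro h
      exact hl.1 (h ▸ List.mem_map.2 ⟨s, hs, rfl⟩)

variable {m b n : ℕ} [NeZero n]

theorem single_modNat (c : Fin (b * n)) (x : K) :
    Pi.single c.modNat (C x * X ^ (c.divNat : ℕ)) = C x • monoVec K n c := by
  rw [monoVec, ← Pi.single_smul]
  rfl

theorem sum_zip_finRange {ι M : Type*} [AddCommMonoid M] {p : List ι} (hp : p.length = m)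
    (f : Fin m × ι → M) :
    (((List.finRange m).zip p).map f).sum =
      ∑ i : Fin m, f (i, p[i]'(i.isLt.trans_eq hp.symm)) := by
  rw [← List.sum_ofFn]
  congr 1
  apply List.ext_getElem
  · simp [hp]
  · intro i h1 h2
    simp

omit [NeZero n] in
theorem nodup_fst_zip_tail_finRange {ι : Type*} (q : List ι) :
    ((((List.finRange n).tail).zip q).map Prod.fst).Nodup := by
  suffices h : ∀ l : List (Fin n), l.Nodup → ((l.zip q).map Prod.fst).Nodup from
    h _ (List.nodup_finRange n).tail
  intro l hl
  induction l generalizing q with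
  | nil => simp
  | cons x l ih =>
    cases q with
    | nil => simp
    | cons y q =>
      rw [List.nodup_cons] at hl
      rw [List.zip_cons_cons, List.map_cons, List.nodup_cons]
      refine ⟨fun h => ?_, ih q hl.2⟩
      obtain ⟨t, ht, hx⟩ := List.mem_map.1 h
      have hx : t.1 = x := hx
      exact hl.1 (hx ▸ (List.of_mem_zip ht).1)

theorem zero_notMem_tail_finRange : (0 : Fin n) ∉ (List.finRange n).tail := by
  obtain ⟨k, rfl⟩ := Nat.exists_eq_succ_of_ne_zero (NeZero.ne n)
  rw [List.finRange_succ, List.tail_cons, List.mem_map]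
  rintro ⟨x, -, hx⟩
  exact Fin.succ_ne_zero x hx

/-- The column numbers in `js` are all nonzero, so only the entries of the last column of `E`
contribute. -/
theorem readOff_col_zero (E : Matrix (Fin m) (Fin (b * n) ⊕ Unit) K) {p : List (Fin (b * n))}
    (q : List (Fin (b * n))) (hp : p.length = m) :
    (readOff E p q).col 0 =
      ∑ i : Fin m, C (E i (.inr ())) • monoVec K n (p[i]'(i.isLt.trans_eq hp.symm)) := by
  have h0 : (0 : Fin n) ∉ ((List.finRange n).tail.zip q).map Prod.fst := fun h => by
    obtain ⟨t, ht, h⟩ := List.mem_map.1 h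
    exact zero_notMem_tail_finRange (h ▸ (List.of_mem_zip ht).1)
  have hadd : ∀ M N : Matrix (Fin n) (Fin n) K[X], ∀ j, (M + N).col j = M.col j + N.col j :=
    fun _ _ _ => rfl
  have hsub : ∀ M N : Matrix (Fin n) (Fin n) K[X], ∀ j, (M - N).col j = M.col j - N.col j :=
    fun _ _ _ => rfl
  simp only [readOff, hadd, hsub, col_sum_map, col_single]
  rw [sum_map_ite_eq_zero _ h0, zero_add, sum_zip_finRange hp]
  refine Finset.sum_congr rfl fun i _ => ?_
  dsimp only
  rw [if_pos trivial, sum_map_ite_eq_zero _ h0, sub_zero, single_modNat]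

/-- Column numbers in `js` do not repeat, so only the pair `t` contributes to this column. -/
theorem readOff_col (E : Matrix (Fin m) (Fin (b * n) ⊕ Unit) K) {p : List (Fin (b * n))}
    (q : List (Fin (b * n))) (hp : p.length = m) {t : Fin n × Fin (b * n)}
    (ht : t ∈ (List.finRange n).tail.zip q) :
    (readOff E p q).col t.1 = monoVec K n t.2 -
      ∑ i : Fin m, C (E i (.inl t.2)) • monoVec K n (p[i]'(i.isLt.trans_eq hp.symm)) := by
  have h0 : (0 : Fin n) ≠ t.1 := fun h =>
    zero_notMem_tail_finRange (h ▸ (List.of_mem_zip ht).1)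
  have hadd : ∀ M N : Matrix (Fin n) (Fin n) K[X], ∀ j, (M + N).col j = M.col j + N.col j :=
    fun _ _ _ => rfl
  have hsub : ∀ M N : Matrix (Fin n) (Fin n) K[X], ∀ j, (M - N).col j = M.col j - N.col j :=
    fun _ _ _ => rfl
  simp only [readOff, hadd, hsub, col_sum_map, col_single]
  rw [sum_map_ite_eq (nodup_fst_zip_tail_finRange q) _ ht, sum_zip_finRange hp,
    sub_eq_add_neg, ← Finset.sum_neg_distrib]
  refine congrArg₂ _ rfl (Finset.sum_congr rfl fun i _ => ?_)
  dsimp only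
  rw [if_neg h0, sum_map_ite_eq (nodup_fst_zip_tail_finRange q) _ ht, zero_sub, single_modNat]

theorem isReducedFrame_omf [DecidableEq K] {a : Fin n → K[X]} (ha : IsMonicGcd a 1)
    (rule : PivotRule K (2 * vecNatDegree a + 1)) : ∃ q, IsReducedFrame a (omf a rule) q := by
  have H : GJInvariant (sylvesterMatrix a) (gaussJordan rule (sylvesterMatrix a))
    ((vecNatDegree a + 1) * n) := gjInvariant_gaussJordan _ rule
  have homf : omf a rule = readOff (partialRref (gaussJordan rule (sylvesterMatrix a))
      (augmentedMatrix a)) (gaussJordan rule (sylvesterMatrix a)).pivots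
      (gaussJordan rule (sylvesterMatrix a)).basic := rfl
  generalize gaussJordan rule (sylvesterMatrix a) = st at H homf
  have hlen := H.length_pivots ha
  have hbas := H.length_basic ha
  -- Columns are counted from `0` and column `0` is no syzygy, so column `j` belongs to entry `j -
  -- 1` of `st.basic`.
  have hlt : ∀ j : Fin n, j ≠ 0 → (j : ℕ) - 1 < st.basic.length := fun j hj => by
    have h1 := j.isLt
    have h2 := Fin.val_ne_zero_iff.2 hj
    omega
  have hmem : ∀ (j : Fin n) (hj : j ≠ 0),
      (j, st.basic[(j : ℕ) - 1]'(hlt j hj)) ∈ (List.finRange n).tail.zip st.basic :=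
    fun j hj => by
    have h2 := Fin.val_ne_zero_iff.2 hj
    rw [List.mem_iff_getElem]
    refine ⟨(j : ℕ) - 1, ?_, ?_⟩
    · rw [List.length_zip, List.length_tail, List.length_finRange]
      have := hlt j hj
      omega
    · rw [List.getElem_zip, List.getElem_tail, List.getElem_finRange]
      refine Prod.ext (Fin.ext ?_) rfl
      simp only [Fin.val_cast]
      omega
  have hcol : ∀ (j : Fin n) (hj : j ≠ 0), IsLead ((omf a rule).col j)
      (st.basic[(j : ℕ) - 1]'(hlt j hj)) ∧ a ⬝ᵥ (omf a rule).col j = 0 := fun j hj => by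
    refine H.isLead_dotProduct_basic ha (List.getElem_mem (hlt j hj)) ?_
    rw [homf, readOff_col _ _ hlen (hmem j hj)]
    refine congrArg₂ _ rfl (Finset.sum_congr rfl fun i _ => ?_)
    rw [partialRref, Matrix.of_apply]
    dsimp only
    rw [if_pos (Or.inr (List.getElem_mem (hlt j hj)))]
    rfl
  have hcol0 : (omf a rule).col 0 = ∑ i : Fin (2 * vecNatDegree a + 1),
      C (applyOps st.ops (Pi.single 0 1) i) •
        monoVec K n (st.pivots[i]'(i.isLt.trans_eq hlen.symm)) := by
    rw [homf, readOff_col_zero _ _ hlen]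
    rfl
  have hmod : ∀ (h : Fin n → K[X]) (c : ℕ), a ⬝ᵥ h = 0 → IsLead h c →
      ∀ (j : Fin n) (hj : j ≠ 0), c % n = (st.basic[(j : ℕ) - 1]'(hlt j hj) : ℕ) % n →
      (st.basic[(j : ℕ) - 1]'(hlt j hj) : ℕ) ≤ c := fun h c h0 hc j hj hcj => by
    by_contra! hlt'
    have hcN := hlt'.trans (Fin.isLt _)
    -- A lead is not pivotal, so its class has a basic index `x ≤ c`; since classes have at most one
    -- basic index, `x` is the given one.
    rcases H.covers ⟨c, hcN⟩ hcN with hp | ⟨x, hx, hxc, hxm⟩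
    · exact H.lead_notMem_pivotSet ha.ne_zero h0 hc (mem_pivotSet.2 hp)
    · have h1 := H.eq_of_modNat_eq hx (List.getElem_mem (hlt j hj))
        (hxm.trans (Fin.ext hcj))
      rw [← h1] at hlt'
      exact absurd hxc (not_le.2 hlt')
  -- The value at `j = 0` is a dummy; no condition on `q` involves it.
  refine ⟨fun j => if hj : j ≠ 0 then (st.basic[(j : ℕ) - 1]'(hlt j hj) : ℕ) else 0, ?_⟩
  exact
  { dot_zero := by rw [hcol0, H.dotProduct_last ha]
    dot := fun j hj => (hcol j hj).2
    lead := fun j hj => by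
      rw [dif_pos hj]
      exact (hcol j hj).1
    lt := fun i j hi hij => by
      have hij' : (i : ℕ) < j := hij
      have hj : j ≠ 0 := fun h => by simp [h] at hij'
      have hi' := Fin.val_ne_zero_iff.2 hi
      rw [dif_pos hi, dif_pos hj]
      exact List.pairwise_iff_getElem.1 H.basic_sorted _ _ (hlt i hi) (hlt j hj) (by omega)
    mod := fun i j hi hj hij => by
      rw [dif_pos hi, dif_pos hj] at hij
      have h1 := H.eq_of_modNat_eq (List.getElem_mem (hlt i hi)) (List.getElem_mem (hlt j hj))
        (Fin.ext hij)
      have hnd : st.basic.Nodup := H.basic_sorted.imp fun h => h.ne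
      have h2 := (hnd.getElem_inj_iff).1 h1
      have hi' := Fin.val_ne_zero_iff.2 hi
      have hj' := Fin.val_ne_zero_iff.2 hj
      exact Fin.ext (by omega)
    min := fun h c h0 hc j hj hcj => by
      rw [dif_pos hj] at hcj ⊢
      exact hmod h c h0 hc j hj hcj
    -- The first column is supported on pivotal indices, so its lead is pivotal, unlike that of a
    -- syzygy.
    lead_zero := fun h c h0 hc hlead => by
      refine H.lead_notMem_pivotSet ha.ne_zero h0 hc ?_
      by_contra hp
      refine hlead.1 ?_
      rw [hcol0, coef_sum]
      refine Finset.sum_eq_zero fun i _ => ?_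
      rw [coef_C_smul, coef_monoVec, if_neg, mul_zero]
      rintro rfl
      exact hp (mem_pivotSet.2 (List.getElem_mem _)) }

end Output

end OMF

theorem mainTheorem7 {K : Type*} [Field K] [DecidableEq K] (n : ℕ) [NeZero n] (hn : 1 < n)
    (a : Fin n → Polynomial K) (ha : OMF.IsMonicGcd a 1)
    (rule : OMF.PivotRule K (2 * OMF.vecNatDegree a + 1)) :
    OMF.IsDegreeOptimalFrame a (OMF.omf a rule) := by
  obtain ⟨q, H⟩ := OMF.isReducedFrame_omf ha rule
  exact H.isDegreeOptimalFrame ha
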